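/- Let $H,\mathcal T\subset\mathbb C$ and let $F:\overline{\mathcal T}\to\mathbb C$ be a map (closures of sets are taken in $\mathbb C$ unless stated otherwise). An *unbounded Jordan domain* is an unbounded domain in $\mathbb C$ whose boundary in the Riemann sphere is a Jordan curve. We say that $F\in\mathcal B_{log}$ if the following hold. (A) $H$ is an unbounded Jordan domain, invariant under $z\mapsto z\pm 2\pi i$, and contains a right half-plane. (B) $\mathcal T\neq\emptyset$ is invariant under $z\mapsto z\pm 2\pi i$, and $\operatorname{Re}$ is bounded below but unbounded above on $\mathcal T$. (C) Each connected component $T$ of $\mathcal T$ (called a *tract*) is an unbounded Jordan domain disjoint from $T+2\pi i k$ for every $k\in\mathbb Z\setminus\{0\}$. (D) For each tract $T$, the restriction $F:T\to H$ is a conformal isomorphism. (E) $F$ is continuous on $\overline{\mathcal T}$, and for each tract $T$, $F(z)\to\infty$ as $z\to\infty$ in $\overline T$. (F) If $(z_n)$ is a sequence of points of $\mathcal T$ lying in pairwise different tracts, then $z_n\to\infty$. $F$ is of *disjoint type* if $\overline{\mathcal T}\subset H$. Let $$J(F)=\{z\in\mathbb C: F^n(z)\in\overline{\mathcal T}\text{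 for all }n\ge 0\},\qquad I(F)=\{z\in J(F):\operatorname{Re}F^n(z)\to+\infty\text{ as }n\to\infty\}.$$ An *external address* is a sequence $\underline s=s_0s_1s_2\ldots$ of tracts; it is *bounded* if only finitely many different tracts occur in it. Let $$J_{\underline s}(F)=\{z\in J(F):F^n(z)\in\overline{s_n}\text{ for all }n\ge 0\}.$$ **Lemma.** Suppose that $F\in\mathcal B_{log}$ is of disjoint type, and that $\underline s$ is a bounded external address. Then there is exactly one point $z_0$ in $J_{\underline s}(F)\setminus I(F)$, and the orbit $\{F^n(z_0):n\ge 0\}$ is bounded. -/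

import Mathlib

open Set Filter Topology

namespace BLog

/-- `S` is invariant under translation by `2πi` (in both directions). -/
def IsTwoPiIPeriodic (S : Set ℂ) : Prop :=
  ∀ z : ℂ, z + 2 * Real.pi * Complex.I ∈ S ↔ z ∈ S

/-- An unbounded Jordan domain: an unbounded nonempty connected open subset `U` of `ℂ` whose
boundary in the Riemann sphere `OnePoint ℂ` is a Jordan curve. (As `U` is unbounded, this curve
passes through `∞`; as `U` is open, connected and disjoint from the curve, while its boundary is
the curve, `U` is one of the complementary components of the curve.) -/
structure IsUnboundedJordanDomain (U : Set ℂ) : Prop where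
  isOpen : IsOpen U
  isConnected : IsConnected U
  unbounded : ¬ Bornology.IsBounded U
  boundary : ∃ γ : Circle → OnePoint ℂ, Continuous γ ∧ Function.Injective γ ∧
    Set.range γ = frontier ((fun z : ℂ => (z : OnePoint ℂ)) '' U)

/-- The tracts: the connected components of `𝒯`. -/
def tracts (𝒯 : Set ℂ) : Set (Set ℂ) :=
  {T | ∃ z ∈ 𝒯, T = connectedComponentIn 𝒯 z}

/-- `F : 𝒯 → H`, extended continuously to the closure of `𝒯`, belongs to the class `B_log`.
The map is represented by a total function `F : ℂ → ℂ`, of which only the values on `closure 𝒯`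
matter. -/
structure IsBLog (𝒯 H : Set ℂ) (F : ℂ → ℂ) : Prop where
  H_periodic : IsTwoPiIPeriodic H
  H_jordan : IsUnboundedJordanDomain H
  H_rightHalfPlane : ∃ R : ℝ, {z : ℂ | R < z.re} ⊆ H
  nonempty : 𝒯.Nonempty
  periodic : IsTwoPiIPeriodic 𝒯
  re_bddBelow : BddBelow (Complex.re '' 𝒯)
  re_not_bddAbove : ¬ BddAbove (Complex.re '' 𝒯)
  tract_jordan : ∀ T ∈ tracts 𝒯, IsUnboundedJordanDomain T
  tract_disjoint : ∀ T ∈ tracts 𝒯, ∀ k : ℤ, k ≠ 0 →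
    Disjoint T ((fun z : ℂ => z + k * (2 * Real.pi * Complex.I)) '' T)
  /-- `F` is a conformal isomorphism of each tract onto `H`. -/
  holomorphic : ∀ T ∈ tracts 𝒯, DifferentiableOn ℂ F T
  bijective : ∀ T ∈ tracts 𝒯, Set.BijOn F T H
  /-- `F` is the continuous extension to the closure, with `F ∞ = ∞` on the closure of each tract
  in the Riemann sphere. -/
  continuousOn_closure : ContinuousOn F (closure 𝒯)
  map_infty : ∀ T ∈ tracts 𝒯, Tendsto F (cocompact ℂ ⊓ 𝓟 (closure T)) (cocompact ℂ)
  /-- The tracts accumulate only at infinity. -/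
  accumulate : ∀ z : ℕ → ℂ, (∀ n, z n ∈ 𝒯) →
    (∀ m n, m ≠ n → connectedComponentIn 𝒯 (z m) ≠ connectedComponentIn 𝒯 (z n)) →
    Tendsto z atTop (cocompact ℂ)

/-- Disjoint type: the closure of `𝒯` in the plane is contained in `H`. -/
def IsDisjointType (𝒯 H : Set ℂ) : Prop := closure 𝒯 ⊆ H

/-- The Julia set `J(F)`: all iterates stay in `closure 𝒯`, where `F` is defined. -/
def julia (𝒯 : Set ℂ) (F : ℂ → ℂ) : Set ℂ :=
  {z | ∀ n : ℕ, F^[n] z ∈ closure 𝒯}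

/-- The escaping set `I(F)`. -/
def escaping (𝒯 : Set ℂ) (F : ℂ → ℂ) : Set ℂ :=
  {z | z ∈ julia 𝒯 F ∧ Tendsto (fun n : ℕ => (F^[n] z).re) atTop atTop}

/-- External addresses: sequences of tracts. -/
def IsExternalAddress (𝒯 : Set ℂ) (s : ℕ → Set ℂ) : Prop := ∀ n, s n ∈ tracts 𝒯

/-- A bounded external address contains only finitely many symbols. -/
def IsBoundedExternalAddress (𝒯 : Set ℂ) (s : ℕ → Set ℂ) : Prop :=
  IsExternalAddress 𝒯 s ∧ (Set.range s).Finite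

/-- `J_s(F)`: the points of `J(F)` with external address `s`. -/
def juliaAddress (𝒯 : Set ℂ) (F : ℂ → ℂ) (s : ℕ → Set ℂ) : Set ℂ :=
  {z | z ∈ julia 𝒯 F ∧ ∀ n : ℕ, F^[n] z ∈ closure (s n)}

end BLog

/-! Run the dynamics backwards. By disjoint type, the inverse branches of `F` on `H` with values in
the tracts `s n` map `H` into the closed set `E`, the union of the closures of the finitely many
tracts in `s`, and `E ⊆ H`. A point `z` of `J_s` is recovered from its orbit by applying the first
`n` branches to `F^[n] z`. Each branch has image disjoint from its `2πi`-translate, so a Bloch-type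
bound controls its derivative (`norm_deriv_mul_le_of_ne_add_two_pi_I`). Hence the branches are
1/2-Lipschitz far to the right, which yields compact invariant sets (`exists_invariant_compact`). An
Earle–Hamilton argument (`norm_deriv_comp_backward_le`) then shows that compositions of branches
contract compact subsets of `H` uniformly. Existence: intersect nested backward images of an
invariant compact set. Uniqueness: a nonescaping orbit returns infinitely often to the compact set
`E ∩ {Re ≤ R}`; pulling back from these times confines it to an invariant compact set, and
contraction identifies any two such orbits. -/

namespace BLog

open Metric

/-! ### Holomorphic functions: a Bloch-type bound and inverses -/

/-- A weak form of Bloch's theorem for functions whose image is disjoint from its translate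
by `2πi`. -/
theorem norm_deriv_mul_le_of_ne_add_two_pi_I {f : ℂ → ℂ} {U : Set ℂ} {a : ℂ} {r : ℝ}
    (hU : IsOpen U) (hf : DifferentiableOn ℂ f U) (hr : 0 < r) (ha : closedBall a r ⊆ U)
    (hne : ∀ z ∈ U, ∀ w ∈ U, f z ≠ f w + 2 * Real.pi * Complex.I) :
    ‖deriv f a‖ * r ≤ 256 * Real.pi := by
  by_cases h0 : deriv f a = 0
  · simp [h0]; positivity
  have hdf : DifferentiableOn ℂ (deriv f) U := hf.deriv hU
  -- Landau's trick: at a maximum `b` of this weight, `‖deriv f‖` at most doubles on the disc about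
  -- `b` of half the remaining radius.
  obtain ⟨b, hb, hmax⟩ := (isCompact_closedBall a r).exists_isMaxOn (nonempty_closedBall.2 hr.le)
    (f := fun z => ‖deriv f z‖ * (r - dist z a))
    ((hdf.continuousOn.mono ha).norm.mul (by fun_prop))
  have h1 : ‖deriv f a‖ * r ≤ ‖deriv f b‖ * (r - dist b a) := by
    simpa using hmax (mem_closedBall_self hr.le)
  have hpos : 0 < ‖deriv f b‖ * (r - dist b a) := lt_of_lt_of_le (by positivity) h1
  have hba : dist b a ≤ r := hb
  set m := ‖deriv f b‖ with hm
  have hm0 : 0 < m := by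
    by_contra h
    have : m = 0 := le_antisymm (not_lt.1 h) (norm_nonneg _)
    simp [this] at hpos
  have hd0 : 0 < r - dist b a := by
    by_contra h
    nlinarith
  obtain ⟨t, ht⟩ : ∃ t, t = (r - dist b a) / 2 := ⟨_, rfl⟩
  have ht0 : 0 < t := by linarith
  have hsub : ball b t ⊆ closedBall a r := by
    intro z hz
    have : dist z a ≤ dist z b + dist b a := dist_triangle ..
    rw [mem_ball] at hz
    rw [mem_closedBall]; linarith
  have hbound : ∀ z ∈ ball b t, ‖deriv f z‖ ≤ 2 * m := by
    intro z hz
    have h2 : ‖deriv f z‖ * (r - dist z a) ≤ m * (r - dist b a) := hmax (hsub hz)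
    have h3 : dist z a ≤ dist z b + dist b a := dist_triangle ..
    rw [mem_ball] at hz
    have h4 : t ≤ r - dist z a := by linarith
    have h5 : ‖deriv f z‖ * t ≤ ‖deriv f z‖ * (r - dist z a) := by gcongr
    have h6 : ‖deriv f z‖ * t ≤ (2 * m) * t := by
      calc _ ≤ m * (r - dist b a) := h5.trans h2
        _ = _ := by rw [ht]; ring
    exact le_of_mul_le_mul_right h6 ht0
  have hlip : ∀ z ∈ ball b t, dist (deriv f z) (deriv f b) ≤ 4 * m / t * dist z b := by
    intro z hz
    refine Complex.dist_le_div_mul_dist_of_mapsTo_ball (hdf.mono (hsub.trans ha)) ?_ hz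
    intro w hw
    rw [mem_closedBall, dist_eq_norm]
    calc _ ≤ ‖deriv f w‖ + ‖deriv f b‖ := norm_sub_le _ _
      _ ≤ 2 * m + m := by gcongr; exact hbound w hw
      _ ≤ _ := by linarith
  -- With `ρ = t / 8` the derivative varies by at most `m / 2`, so `f` is close to its linear part.
  obtain ⟨ρ, hρ⟩ : ∃ ρ, ρ = t / 8 := ⟨_, rfl⟩
  have hρ0 : 0 < ρ := by linarith
  have hρt : closedBall b ρ ⊆ ball b t := closedBall_subset_ball (by linarith)
  have hfd : ∀ z ∈ closedBall b ρ, DifferentiableAt ℂ f z := fun z hz =>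
    hf.differentiableAt (hU.mem_nhds (ha (hsub (hρt hz))))
  have hlin : ∀ z ∈ closedBall b ρ, ‖f z - f b - deriv f b * (z - b)‖ ≤ m / 2 * ‖z - b‖ := by
    intro z hz
    have := (convex_closedBall b ρ).norm_image_sub_le_of_norm_hasDerivWithin_le
      (f := fun z => f z - deriv f b * z) (f' := fun z => deriv f z - deriv f b) (C := m / 2)
      (fun x hx => ?_) (fun x hx => ?_) (mem_closedBall_self hρ0.le) hz
    · have e : f z - f b - deriv f b * (z - b) =
          f z - deriv f b * z - (f b - deriv f b * b) := by ring
      rw [e]; exact this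
    · have h := ((hfd x hx).hasDerivAt.sub
        ((hasDerivAt_id x).const_mul (deriv f b))).hasDerivWithinAt (s := closedBall b ρ)
      rw [mul_one] at h
      exact h
    · rw [← dist_eq_norm]
      refine (hlip x (hρt hx)).trans ?_
      rw [mem_closedBall] at hx
      calc 4 * m / t * dist x b ≤ 4 * m / t * ρ := by gcongr
        _ = m / 2 := by rw [hρ]; field_simp; norm_num
  have hlow : ∀ z ∈ closedBall b ρ, m / 2 * ‖z - b‖ ≤ ‖f z - f b‖ := by
    intro z hz
    have h2 := hlin z hz
    have h3 : ‖deriv f b * (z - b)‖ ≤ ‖f z - f b‖ + ‖f z - f b - deriv f b * (z - b)‖ := by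
      rw [← norm_neg (f z - f b - deriv f b * (z - b))]
      refine le_trans (le_of_eq ?_) (norm_add_le _ _)
      congr 1; ring
    rw [norm_mul, ← hm] at h3
    linarith
  have himg : ball (f b) (m / 2 * ρ / 2) ⊆ f '' closedBall b ρ := by
    refine DiffContOnCl.ball_subset_image_closedBall ?_ hρ0 ?_ ?_
    · refine DifferentiableOn.diffContOnCl fun z hz => (hfd z ?_).differentiableWithinAt
      exact closure_ball_subset_closedBall hz
    · intro z hz
      have h2 := hlow z (sphere_subset_closedBall hz)
      rwa [← dist_eq_norm, mem_sphere.1 hz] at h2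
    · have h2 : ∀ᶠ z in 𝓝[≠] b, f z ≠ f b := by
        filter_upwards [self_mem_nhdsWithin,
          mem_nhdsWithin_of_mem_nhds (closedBall_mem_nhds b hρ0)] with z hz hz' heq
        have := hlow z hz'
        rw [heq, sub_self, norm_zero] at this
        have h3 : 0 < ‖z - b‖ := norm_pos_iff.2 (sub_ne_zero.2 hz)
        nlinarith
      exact h2.frequently.filter_mono nhdsWithin_le_nhds
  by_contra hcon
  have hbig : 2 * Real.pi < m / 2 * ρ / 2 := by
    have : 256 * Real.pi < m * (2 * t) := by
      have : m * (2 * t) = m * (r - dist b a) := by rw [ht]; ring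
      linarith
    rw [hρ]; nlinarith
  have hmem : f b + 2 * Real.pi * Complex.I ∈ ball (f b) (m / 2 * ρ / 2) := by
    simpa [abs_of_pos Real.pi_pos] using hbig
  obtain ⟨z, hz, hzeq⟩ := himg hmem
  exact hne z (ha (hsub (hρt hz))) b (ha hb) hzeq

/-- The inverse of an injective holomorphic function is holomorphic. -/
theorem differentiableOn_of_injOn_of_rightInverse {f g : ℂ → ℂ} {T H : Set ℂ} (hT : IsOpen T)
    (hf : DifferentiableOn ℂ f T) (hinj : InjOn f T) (hg : MapsTo g H T)
    (hfg : ∀ w ∈ H, f (g w) = w) (hfT : MapsTo f T H) : DifferentiableOn ℂ g H := by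
  have hgf : ∀ z ∈ T, g (f z) = z := fun z hz => hinj (hg (hfT hz)) hz (hfg _ (hfT hz))
  have hconst : ∀ z ∈ T, ¬ ∀ᶠ y in 𝓝 z, f y = f z := by
    intro z hz h
    have h2 : ∀ᶠ y in 𝓝[≠] z, False := by
      filter_upwards [self_mem_nhdsWithin, mem_nhdsWithin_of_mem_nhds h,
        mem_nhdsWithin_of_mem_nhds (hT.mem_nhds hz)] with y hy1 hy2 hy3
      exact hy1 (hinj hy3 hz hy2)
    exact h2.exists.choose_spec
  have hopen : ∀ w ∈ H, map f (𝓝 (g w)) = 𝓝 w := by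
    intro w hw
    have han := hf.analyticAt (hT.mem_nhds (hg hw))
    refine le_antisymm ?_ ?_
    · have := han.continuousAt.tendsto
      rwa [hfg w hw] at this
    · have := han.eventually_constant_or_nhds_le_map_nhds.resolve_left (hconst _ (hg hw))
      rwa [hfg w hw] at this
  have hnhds : ∀ w ∈ H, ∀ V ∈ 𝓝 (g w), ∀ᶠ y in 𝓝 w, y ∈ H ∧ g y ∈ V := by
    intro w hw V hV
    rw [← hopen w hw, eventually_map]
    filter_upwards [hV, hT.mem_nhds (hg hw)] with z hz hzT
    exact ⟨hfT hzT, by rwa [hgf z hzT]⟩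
  have hcont : ∀ w ∈ H, ContinuousAt g w := fun w hw V hV => (hnhds w hw V hV).mono fun _ h => h.2
  -- Critical points of `f` are isolated, so `g` is differentiable on a punctured neighbourhood of
  -- `w`; continuity removes the singularity.
  intro w hw
  refine (Complex.analyticAt_of_differentiable_on_punctured_nhds_of_continuousAt ?_
    (hcont w hw)).differentiableAt.differentiableWithinAt
  have hder : ∀ᶠ z in 𝓝[≠] (g w), deriv f z ≠ 0 := by
    refine ((hf.analyticAt (hT.mem_nhds (hg hw))).deriv
      |>.eventually_eq_zero_or_eventually_ne_zero).resolve_left fun h => ?_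
    obtain ⟨ε, hε, hball⟩ := Metric.eventually_nhds_iff_ball.1
      (h.and (hT.mem_nhds (hg hw)))
    refine hconst _ (hg hw) (Filter.mem_of_superset (ball_mem_nhds _ hε) fun y hy => ?_)
    exact isOpen_ball.is_const_of_deriv_eq_zero (convex_ball _ _).isPreconnected
      (hf.mono fun z hz => (hball z hz).2) (fun z hz => (hball z hz).1) hy (mem_ball_self hε)
  have hev := hnhds w hw _ (mem_nhdsWithin_iff_eventually.1 hder)
  filter_upwards [self_mem_nhdsWithin, mem_nhdsWithin_of_mem_nhds hev] with y hy ⟨hyH, hyd⟩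
  have hne : deriv f (g y) ≠ 0 := hyd fun h => hy (by
    rw [mem_singleton_iff, ← hfg y hyH, h, hfg w hw])
  refine (HasDerivAt.of_local_left_inverse (hcont y hyH)
    (hf.differentiableAt (hT.mem_nhds (hg hyH))).hasDerivAt hne ?_).differentiableAt
  filter_upwards [hnhds y hyH univ univ_mem] with x hx using hfg x hx.1

/-! ### Contraction by compositions of inverse branches -/

/-- A sequence of holomorphic self-maps `g n` of a domain `H`, with only finitely many different
terms, whose images avoid their `2πi`-translates and lie in a closed set `E ⊆ H` that is bounded in
every left half-plane. -/
structure IsContractingSystem (H E : Set ℂ) (g : ℕ → ℂ → ℂ) : Prop where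
  isOpen : IsOpen H
  isPreconnected : IsPreconnected H
  rightHalfPlane : ∃ R : ℝ, {z : ℂ | R < z.re} ⊆ H
  holomorphic : ∀ n, DifferentiableOn ℂ (g n) H
  mapsTo : ∀ n, MapsTo (g n) H E
  isClosed : IsClosed E
  subset : E ⊆ H
  isBounded : ∀ R : ℝ, Bornology.IsBounded {z ∈ E | z.re ≤ R}
  ne_add : ∀ n, ∀ z ∈ H, ∀ w ∈ H, g n z ≠ g n w + 2 * Real.pi * Complex.I
  finite : (range g).Finite

/-- The composition `g a ∘ g (a + 1) ∘ ⋯ ∘ g (a + n - 1)`. -/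
def backward (g : ℕ → ℂ → ℂ) : ℕ → ℕ → ℂ → ℂ
  | _, 0 => id
  | a, n + 1 => g a ∘ backward g (a + 1) n

theorem backward_succ' (g : ℕ → ℂ → ℂ) (a n : ℕ) (z : ℂ) :
    backward g a (n + 1) z = backward g a n (g (a + n) z) := by
  induction n generalizing a with
  | zero => rfl
  | succ n ih =>
    have := ih (a + 1)
    simp only [backward, Function.comp_apply] at this ⊢
    rw [this, Nat.add_right_comm, Nat.add_assoc]

theorem mapsTo_backward {g : ℕ → ℂ → ℂ} {Q : Set ℂ} (hQ : ∀ n, MapsTo (g n) Q Q) (a n : ℕ) :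
    MapsTo (backward g a n) Q Q := by
  induction n generalizing a with
  | zero => exact mapsTo_id _
  | succ n ih => exact (hQ a).comp (ih (a + 1))

namespace IsContractingSystem

variable {H E : Set ℂ} {g : ℕ → ℂ → ℂ}

theorem mapsTo_self (h : IsContractingSystem H E g) (n : ℕ) : MapsTo (g n) H H :=
  (h.mapsTo n).mono_right h.subset

theorem isCompact_re_le (h : IsContractingSystem H E g) (R : ℝ) :
    IsCompact {z ∈ E | z.re ≤ R} :=
  isCompact_of_isClosed_isBounded
    (h.isClosed.inter (isClosed_le Complex.continuous_re continuous_const)) (h.isBounded R)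

/-- Boundedness of the images of a compact set, uniformly in the system. -/
theorem exists_image_subset_closedBall (h : IsContractingSystem H E g) {K : Set ℂ}
    (hK : IsCompact K) (hKH : K ⊆ H) (p : ℂ) :
    ∃ B : ℝ, ∀ n, ∀ z ∈ K, dist (g n z) p ≤ B := by
  have hb : Bornology.IsBounded (⋃ f ∈ range g, f '' K) := by
    refine (Bornology.isBounded_biUnion h.finite).2 ?_
    rintro _ ⟨n, rfl⟩
    exact (hK.image_of_continuousOn ((h.holomorphic n).continuousOn.mono hKH)).isBounded
  obtain ⟨B, hB⟩ := hb.subset_closedBall p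
  exact ⟨B, fun n z hz => hB (mem_biUnion (mem_range_self n) (mem_image_of_mem _ hz))⟩

/-- Far to the right, discs of radius `512π` fit into `H`, and the Bloch-type bound gives derivative
at most `256π / 512π`. -/
theorem exists_half_lipschitz (h : IsContractingSystem H E g) :
    ∃ R : ℝ, {z : ℂ | R ≤ z.re} ⊆ H ∧ ∀ n, ∀ z w : ℂ, R ≤ z.re → R ≤ w.re →
      dist (g n z) (g n w) ≤ 1 / 2 * dist z w := by
  obtain ⟨R, hR⟩ := h.rightHalfPlane
  have hpi := Real.pi_pos
  obtain ⟨L, hL⟩ : ∃ L, L = 512 * Real.pi := ⟨_, rfl⟩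
  have hsub : {z : ℂ | R + L + 1 ≤ z.re} ⊆ H := fun z hz => hR (by
    simp only [mem_ofPred_eq] at hz ⊢; nlinarith)
  refine ⟨R + L + 1, hsub, fun n z w hz hw => ?_⟩
  rw [dist_eq_norm, dist_eq_norm]
  refine (convex_halfSpace_re_ge (R + L + 1)).norm_image_sub_le_of_norm_deriv_le
    (fun x hx => (h.holomorphic n).differentiableAt (h.isOpen.mem_nhds (hsub hx)))
    (fun x hx => ?_) hw hz
  have hball : closedBall x L ⊆ H := by
    intro y hy
    apply hR
    have h1 : |(x - y).re| ≤ ‖x - y‖ := Complex.abs_re_le_norm _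
    rw [mem_closedBall, dist_comm, dist_eq_norm] at hy
    have h2 := le_abs_self (x - y).re
    rw [Complex.sub_re] at h1 h2
    simp only [mem_ofPred_eq] at hx ⊢
    linarith
  have := norm_deriv_mul_le_of_ne_add_two_pi_I h.isOpen (h.holomorphic n) (by nlinarith)
    hball (h.ne_add n)
  rw [hL] at this
  by_contra hc
  rw [not_le] at hc
  nlinarith

/-- Every compact subset of `H` lies in a compact subset that is invariant under the system. -/
theorem exists_invariant_compact (h : IsContractingSystem H E g) {K : Set ℂ}
    (hK : IsCompact K) (hKH : K ⊆ H) :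
    ∃ Q, IsCompact Q ∧ K ⊆ Q ∧ Q ⊆ H ∧ ∀ n, MapsTo (g n) Q Q := by
  obtain ⟨R, hRH, hlip⟩ := h.exists_half_lipschitz
  obtain ⟨p, hp⟩ : ∃ p : ℂ, p.re = R := ⟨R, by simp⟩
  obtain ⟨B, hB⟩ := h.exists_image_subset_closedBall
    (K := K ∪ {z ∈ E | z.re ≤ R} ∪ {p}) ((hK.union (h.isCompact_re_le R)).union isCompact_singleton)
    (union_subset (union_subset hKH fun z hz => h.subset hz.1)
      (singleton_subset_iff.2 (hRH hp.ge))) p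
  have hB0 : 0 ≤ B := dist_nonneg.trans (hB 0 p (by simp))
  -- The radius `2 * B` is chosen so that `1 / 2 * (2 * B) + B = 2 * B`.
  refine ⟨K ∪ (E ∩ closedBall p (2 * B)),
    hK.union ((isCompact_closedBall _ _).inter_left h.isClosed), subset_union_left,
    union_subset hKH (inter_subset_left.trans h.subset), fun n z hz => Or.inr ?_⟩
  rcases hz with hz | ⟨hzE, hzB⟩
  · exact ⟨h.mapsTo n (hKH hz), (hB n z (by simp [hz])).trans (by linarith)⟩
  refine ⟨h.mapsTo n (h.subset hzE), ?_⟩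
  rw [mem_closedBall] at hzB ⊢
  rcases le_total z.re R with hzR | hzR
  · exact (hB n z (Or.inl (Or.inr ⟨hzE, hzR⟩))).trans (by linarith)
  · calc _ ≤ dist (g n z) (g n p) + dist (g n p) p := dist_triangle ..
      _ ≤ 1 / 2 * (2 * B) + B := by
        gcongr
        · exact (hlip n z p hzR hp.ge).trans (by gcongr)
        · exact hB n p (by simp)
      _ = _ := by ring

/-- The maps of the system can be expanded slightly about points of a compact set without leaving
`H`. -/
theorem exists_expansion (h : IsContractingSystem H E g) {Q : Set ℂ} (hQ : IsCompact Q) :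
    ∃ ε : ℝ, 0 < ε ∧ ∀ z ∈ E, ∀ w ∈ Q, z + ε * (z - w) ∈ H := by
  obtain ⟨R, hR⟩ := h.rightHalfPlane
  obtain ⟨B, hB0, hB⟩ := hQ.isBounded.exists_pos_norm_le
  have hK := h.isCompact_re_le (|R| + B + 1)
  obtain ⟨δ, hδ, hδH⟩ := hK.exists_cthickening_subset_open h.isOpen fun z hz => h.subset hz.1
  obtain ⟨C, hC0, hC⟩ := hK.isBounded.exists_pos_norm_le
  -- Where `E` is bounded the displacement is at most `δ`; elsewhere `z` lies to the right of `w`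
  -- and moves further right.
  refine ⟨δ / (C + B), by positivity, fun z hz w hw => ?_⟩
  have hε : 0 < δ / (C + B) := by positivity
  rcases le_or_gt z.re (|R| + B + 1) with hz1 | hz1
  · refine hδH (mem_cthickening_of_dist_le _ z _ _ ⟨hz, hz1⟩ ?_)
    rw [dist_eq_norm, add_sub_cancel_left, norm_mul, Complex.norm_real, Real.norm_of_nonneg hε.le]
    calc _ ≤ δ / (C + B) * (C + B) := by
          gcongr
          exact (norm_sub_le _ _).trans (add_le_add (hC z ⟨hz, hz1⟩) (hB w hw))
      _ = δ := by field_simp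
  · apply hR
    have h1 : w.re ≤ B := (Complex.re_le_norm w).trans (hB w hw)
    have h2 := le_abs_self R
    have h3 : 0 ≤ δ / (C + B) * (z.re - w.re) :=
      mul_nonneg hε.le (by linarith [abs_nonneg R])
    simp only [mem_ofPred_eq, Complex.add_re, Complex.re_ofReal_mul, Complex.sub_re]
    linarith

theorem differentiableOn_backward (h : IsContractingSystem H E g) (a n : ℕ) :
    DifferentiableOn ℂ (backward g a n) H := by
  induction n generalizing a with
  | zero => exact differentiableOn_id
  | succ n ih =>
    exact (h.holomorphic a).comp (ih (a + 1)) (mapsTo_backward h.mapsTo_self (a + 1) n)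

/-- An Earle–Hamilton type estimate: composing with compositions of the system shrinks derivatives
geometrically. -/
theorem norm_deriv_comp_backward_le (h : IsContractingSystem H E g) {Q : Set ℂ} (hQH : Q ⊆ H)
    (hQ : ∀ n, MapsTo (g n) Q Q) {ε δ : ℝ} (hε : 0 < ε) (hδ : 0 < δ)
    (hexp : ∀ z ∈ E, ∀ w ∈ Q, z + ε * (z - w) ∈ H) (hQδ : ∀ z ∈ Q, closedBall z δ ⊆ H)
    {f : ℂ → ℂ} (hf : DifferentiableOn ℂ f H)
    (hne : ∀ z ∈ H, ∀ w ∈ H, f z ≠ f w + 2 * Real.pi * Complex.I) (a n : ℕ) {w : ℂ} (hw : w ∈ Q) :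
    (1 + ε) ^ n * ‖deriv (f ∘ backward g a n) w‖ ≤ 256 * Real.pi / δ := by
  induction n generalizing a f with
  | zero =>
    rw [le_div_iff₀ hδ]
    simpa [backward] using norm_deriv_mul_le_of_ne_add_two_pi_I h.isOpen hf hδ (hQδ w hw) hne
  | succ n ih =>
    obtain ⟨b, hb⟩ : ∃ b, b = backward g (a + 1) n := ⟨_, rfl⟩
    have hbQ : b w ∈ Q := hb ▸ mapsTo_backward hQ (a + 1) n hw
    have hgQ : g a (b w) ∈ Q := hQ a hbQ
    have hdiff : ∀ {u : ℂ → ℂ} {x : ℂ}, DifferentiableOn ℂ u H → x ∈ Q → HasDerivAt u (deriv u x) x :=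
      fun hu hx => (hu.differentiableAt (h.isOpen.mem_nhds (hQH hx))).hasDerivAt
    -- `k` agrees with `g a` at `b w` but has derivative larger by the factor `1 + ε`; the induction
    -- hypothesis for `f ∘ k` gains that factor.
    obtain ⟨k, hk⟩ : ∃ k : ℂ → ℂ, k = fun z => g a z + ε * (g a z - g a (b w)) := ⟨_, rfl⟩
    have hkH : MapsTo k H H := fun z hz => by
      rw [hk]; exact hexp _ (h.mapsTo a hz) _ hgQ
    have hkd : DifferentiableOn ℂ k H := by
      rw [hk]
      exact (h.holomorphic a).add (((h.holomorphic a).sub_const _).const_mul _)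
    have hkw : k (b w) = g a (b w) := by simp [hk]
    have hb' : HasDerivAt b (deriv b w) w := hdiff (hb ▸ h.differentiableOn_backward _ _) hw
    have hg' := hdiff (h.holomorphic a) hbQ
    have hk' : HasDerivAt k ((1 + ε) * deriv (g a) (b w)) (b w) := by
      have := hg'.add ((hg'.sub_const (g a (b w))).const_mul (ε : ℂ))
      rw [hk, one_add_mul]
      exact this
    have hf' := hdiff hf hgQ
    have key := ih (f := f ∘ k) (hf.comp hkd hkH)
      (fun z hz w hw => hne _ (hkH hz) _ (hkH hw)) (a + 1)
    have e1 : deriv ((f ∘ k) ∘ b) w =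
        deriv f (g a (b w)) * ((1 + ε) * deriv (g a) (b w)) * deriv b w :=
      ((((hkw ▸ hf' : HasDerivAt f _ (k (b w)))).comp (b w) hk').comp w hb').deriv
    have e2 : deriv (f ∘ backward g a (n + 1)) w =
        deriv f (g a (b w)) * deriv (g a) (b w) * deriv b w := by
      rw [show f ∘ backward g a (n + 1) = (f ∘ g a) ∘ b by rw [hb]; rfl]
      exact ((hf'.comp (b w) hg').comp w hb').deriv
    have hn : ‖(1 + ε : ℂ)‖ = 1 + ε := by
      rw [show (1 + ε : ℂ) = ((1 + ε : ℝ) : ℂ) by push_cast; rfl, Complex.norm_real,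
        Real.norm_of_nonneg (by linarith)]
    rw [← hb, e1] at key
    rw [e2]
    refine le_trans (le_of_eq ?_) key
    simp only [norm_mul, hn]
    ring

/-- The outermost branch `g a` plays the role of `f`, since the identity need not avoid translates;
hence the shift `n + 1`. -/
theorem exists_norm_deriv_backward_le (h : IsContractingSystem H E g) {K : Set ℂ}
    (hK : IsCompact K) (hKH : K ⊆ H) :
    ∃ C q : ℝ, 0 ≤ q ∧ q < 1 ∧ ∀ a n, ∀ w ∈ K, ‖deriv (backward g a (n + 1)) w‖ ≤ C * q ^ n := by
  obtain ⟨Q, hQc, hKQ, hQH, hQ⟩ := h.exists_invariant_compact hK hKH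
  obtain ⟨ε, hε, hexp⟩ := h.exists_expansion hQc
  obtain ⟨δ, hδ, hδH⟩ := hQc.exists_cthickening_subset_open h.isOpen hQH
  refine ⟨256 * Real.pi / δ, (1 + ε)⁻¹, by positivity, inv_lt_one_of_one_lt₀ (by linarith),
    fun a n w hw => ?_⟩
  have := h.norm_deriv_comp_backward_le hQH hQ hε hδ hexp
    (fun z hz => (closedBall_subset_cthickening hz δ).trans hδH) (h.holomorphic a) (h.ne_add a)
    (a + 1) n (hKQ hw)
  rw [inv_pow, ← div_eq_mul_inv, le_div_iff₀ (by positivity), mul_comm]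
  exact this

theorem exists_dist_backward_le (h : IsContractingSystem H E g) {x : ℂ} (hx : x ∈ H) :
    ∃ r > 0, ∃ u : ℕ → ℝ, Tendsto u atTop (𝓝 0) ∧ ∀ n, ∀ y ∈ closedBall x r,
      dist (backward g 0 n y) (backward g 0 n x) ≤ u n := by
  obtain ⟨r, hr, hrH⟩ := nhds_basis_closedBall.mem_iff.1 (h.isOpen.mem_nhds hx)
  obtain ⟨C, q, hq0, hq1, hC⟩ := h.exists_norm_deriv_backward_le (isCompact_closedBall x r) hrH
  have hb : ∀ n, ∀ y ∈ closedBall x r,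
      dist (backward g 0 (n + 1) y) (backward g 0 (n + 1) x) ≤ C * q ^ n * r := by
    intro n y hy
    rw [dist_eq_norm]
    refine ((convex_closedBall x r).norm_image_sub_le_of_norm_deriv_le
      (fun z hz => (h.differentiableOn_backward 0 (n + 1)).differentiableAt
        (h.isOpen.mem_nhds (hrH hz))) (hC 0 n) (mem_closedBall_self hr.le) hy).trans ?_
    rw [← dist_eq_norm]
    have : 0 ≤ C * q ^ n := (norm_nonneg _).trans (hC 0 n x (mem_closedBall_self hr.le))
    gcongr
    exact hy
  refine ⟨r, hr, fun n => if n = 0 then r else C * q ^ (n - 1) * r, ?_, fun n y hy => ?_⟩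
  · rw [← tendsto_add_atTop_iff_nat 1]
    simpa using ((tendsto_pow_atTop_nhds_zero_of_lt_one hq0 hq1).const_mul C).mul_const r
  · rcases n with _ | n
    · simpa [backward] using hy
    · simpa using hb n y hy

/-- Merging under the compositions is an equivalence relation that holds locally, so it holds
throughout the connected set `H`. -/
theorem tendsto_dist_backward (h : IsContractingSystem H E g) {x y : ℂ} (hx : x ∈ H)
    (hy : y ∈ H) :
    Tendsto (fun n => dist (backward g 0 n x) (backward g 0 n y)) atTop (𝓝 0) := by
  refine h.isPreconnected.induction₂
    (fun x y => Tendsto (fun n => dist (backward g 0 n x) (backward g 0 n y)) atTop (𝓝 0))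
    (fun x hx => ?_) (fun x y z _ _ _ h1 h2 => ?_) (fun x y _ _ h1 => ?_) hx hy
  · obtain ⟨r, hr, u, hu, hle⟩ := h.exists_dist_backward_le hx
    filter_upwards [mem_nhdsWithin_of_mem_nhds (closedBall_mem_nhds x hr)] with y hy
    exact squeeze_zero (fun _ => dist_nonneg) (fun n => (dist_comm _ _).trans_le (hle n y hy)) hu
  · exact squeeze_zero (fun _ => dist_nonneg)
      (fun n => dist_triangle (backward g 0 n x) (backward g 0 n y) (backward g 0 n z))
      (by simpa using h1.add h2)
  · simpa only [dist_comm] using h1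

/-- The compositions of the system contract compact sets to points, uniformly. -/
theorem tendstoUniformlyOn_backward_sub (h : IsContractingSystem H E g) {K : Set ℂ}
    (hK : IsCompact K) (hKH : K ⊆ H) {p : ℂ} (hp : p ∈ H) :
    TendstoUniformlyOn (fun n x => dist (backward g 0 n x) (backward g 0 n p)) 0 atTop K := by
  refine (tendstoLocallyUniformlyOn_iff_forall_isCompact h.isOpen).1 ?_ K hKH hK
  rw [Metric.tendstoLocallyUniformlyOn_iff]
  intro ε hε x hx
  obtain ⟨r, hr, u, hu, hle⟩ := h.exists_dist_backward_le hx
  refine ⟨closedBall x r, mem_nhdsWithin_of_mem_nhds (closedBall_mem_nhds x hr), ?_⟩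
  have hlim := hu.add (h.tendsto_dist_backward hx hp)
  rw [add_zero] at hlim
  filter_upwards [hlim.eventually_lt_const hε] with n hn y hy
  rw [Pi.zero_apply, dist_zero_left, Real.norm_of_nonneg dist_nonneg]
  exact lt_of_le_of_lt ((dist_triangle _ (backward g 0 n x) _).trans
    (add_le_add_left (hle n y hy) _)) hn

end IsContractingSystem

/-! ### Tracts and their inverse branches -/

theorem IsTwoPiIPeriodic.add_int_mul_mem_iff {S : Set ℂ} (hS : IsTwoPiIPeriodic S) (z : ℂ)
    (k : ℤ) : z + k * (2 * Real.pi * Complex.I) ∈ S ↔ z ∈ S := by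
  induction k using Int.induction_on with
  | zero => simp
  | succ k ih =>
    rw [← ih, ← hS (z + ((k : ℤ) : ℂ) * (2 * Real.pi * Complex.I))]
    push_cast
    ring_nf
  | pred k ih =>
    rw [← ih, ← hS]
    push_cast
    ring_nf

theorem connectedComponentIn_add_int_mul {S : Set ℂ} (hS : IsTwoPiIPeriodic S) {z : ℂ}
    (hz : z ∈ S) (k : ℤ) : connectedComponentIn S (z + k * (2 * Real.pi * Complex.I)) =
      (fun w : ℂ => w + k * (2 * Real.pi * Complex.I)) '' connectedComponentIn S z := by
  have h := (Homeomorph.addRight ((k : ℂ) * (2 * Real.pi * Complex.I))).image_connectedComponentIn hz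
  have hS' : (Homeomorph.addRight ((k : ℂ) * (2 * Real.pi * Complex.I))) '' S = S := by
    ext w
    constructor
    · rintro ⟨v, hv, rfl⟩
      exact (hS.add_int_mul_mem_iff v k).2 hv
    · intro hw
      refine ⟨w - k * (2 * Real.pi * Complex.I), ?_, by simp⟩
      rw [← hS.add_int_mul_mem_iff _ k]
      simpa using hw
  rw [hS'] at h
  exact h.symm

namespace IsBLog

variable {𝒯 H : Set ℂ} {F : ℂ → ℂ}

theorem connectedComponentIn_eq_of_mem {T : Set ℂ} (hT : T ∈ tracts 𝒯) {z : ℂ} (hz : z ∈ T) :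
    z ∈ 𝒯 ∧ connectedComponentIn 𝒯 z = T := by
  obtain ⟨w, _, rfl⟩ := hT
  exact ⟨connectedComponentIn_subset _ _ hz, (connectedComponentIn_eq hz).symm⟩

/-- Real parts tend to infinity in each tract. -/
theorem isBounded_tract_re_le (hF : IsBLog 𝒯 H F) {T : Set ℂ} (hT : T ∈ tracts 𝒯) (R : ℝ) :
    Bornology.IsBounded {z ∈ T | z.re ≤ R} := by
  have hpi : 0 < 2 * Real.pi := by positivity
  obtain ⟨L, hL⟩ := hF.re_bddBelow
  have hre : ∀ z ∈ T, L ≤ z.re := fun z hz =>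
    hL (mem_image_of_mem _ (connectedComponentIn_eq_of_mem hT hz).1)
  have hfl : ∀ x : ℝ, ⌊x / (2 * Real.pi)⌋ * (2 * Real.pi) ≤ x ∧
      x ≤ ⌊x / (2 * Real.pi)⌋ * (2 * Real.pi) + 2 * Real.pi := fun x => by
    have h1 := Int.floor_le (x / (2 * Real.pi))
    have h2 := (Int.lt_floor_add_one (x / (2 * Real.pi))).le
    rw [le_div_iff₀ hpi] at h1
    rw [div_le_iff₀ hpi] at h2
    exact ⟨h1, by linarith⟩
  by_cases hfin : ((fun z : ℂ => ⌊z.im / (2 * Real.pi)⌋) '' {z ∈ T | z.re ≤ R}).Finite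
  · obtain ⟨a, ha⟩ := hfin.bddBelow
    obtain ⟨b, hb⟩ := hfin.bddAbove
    refine ((Metric.isBounded_Icc L R).reProdIm
      (Metric.isBounded_Icc (a * (2 * Real.pi)) (b * (2 * Real.pi) + 2 * Real.pi))).subset ?_
    intro z hz
    have h1 : (a : ℝ) ≤ ⌊z.im / (2 * Real.pi)⌋ := by exact_mod_cast ha (mem_image_of_mem _ hz)
    have h2 : (⌊z.im / (2 * Real.pi)⌋ : ℝ) ≤ b := by exact_mod_cast hb (mem_image_of_mem _ hz)
    refine ⟨⟨hre z hz.1, hz.2⟩, le_trans ?_ (hfl z.im).1, (hfl z.im).2.trans ?_⟩ <;> gcongr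
  · exfalso
    have hmem : ∀ n, ∃ z, (z ∈ T ∧ z.re ≤ R) ∧
      ⌊z.im / (2 * Real.pi)⌋ = (Set.Infinite.natEmbedding _ hfin n : ℤ) :=
        fun n => (Set.Infinite.natEmbedding _ hfin n).2
    choose z hz hk using hmem
    obtain ⟨k, hkdef⟩ : ∃ k : ℕ → ℤ, k = fun n => ⌊(z n).im / (2 * Real.pi)⌋ := ⟨_, rfl⟩
    have hkinj : Function.Injective k := fun m n hmn => by
      simp only [hkdef, hk] at hmn
      exact (Set.Infinite.natEmbedding _ hfin).injective (Subtype.ext hmn)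
    -- Translating the points into one period strip gives a bounded sequence in pairwise different
    -- tracts, against `accumulate`.
    obtain ⟨v, hv⟩ : ∃ v : ℕ → ℂ,
      v = fun n => z n + ((-k n : ℤ) : ℂ) * (2 * Real.pi * Complex.I) := ⟨_, rfl⟩
    have hz𝒯 := fun n => connectedComponentIn_eq_of_mem hT (hz n).1
    have hlim := hF.accumulate v
      (fun n => by rw [hv]; exact (hF.periodic.add_int_mul_mem_iff _ _).2 (hz𝒯 n).1) ?_
    · have hbdd : Bornology.IsBounded (Icc L R ×ℂ Icc 0 (2 * Real.pi)) :=
        (Metric.isBounded_Icc _ _).reProdIm (Metric.isBounded_Icc _ _)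
      have hev := hlim.eventually (hbdd.isCompact_closure.compl_mem_cocompact)
      obtain ⟨n, hn⟩ := hev.exists
      refine hn (subset_closure ?_)
      have h1 := hfl (z n).im
      have e1 : (v n).re = (z n).re := by simp [hv]
      have e2 : (v n).im = (z n).im - ⌊(z n).im / (2 * Real.pi)⌋ * (2 * Real.pi) := by
        simp [hv, hkdef, sub_eq_add_neg]
      refine ⟨?_, ?_⟩
      · rw [mem_preimage, e1]; exact ⟨hre _ (hz n).1, (hz n).2⟩
      · rw [mem_preimage, e2]; exact ⟨by linarith, by linarith⟩
    · intro m n hmn heq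
      rw [hv] at heq
      simp only at heq
      rw [connectedComponentIn_add_int_mul hF.periodic (hz𝒯 m).1,
        connectedComponentIn_add_int_mul hF.periodic (hz𝒯 n).1, (hz𝒯 m).2, (hz𝒯 n).2] at heq
      have hmem := heq ▸ mem_image_of_mem _ (hz m).1
      obtain ⟨u, hu, hueq⟩ := hmem
      refine Set.disjoint_left.1 (hF.tract_disjoint T hT (k m - k n)
        (sub_ne_zero.2 fun h => hmn (hkinj h))) (hz m).1 ⟨u, hu, ?_⟩
      simp only at hueq ⊢
      push_cast at hueq ⊢
      linear_combination hueq

theorem isBounded_closure_tract_re_le (hF : IsBLog 𝒯 H F) {T : Set ℂ} (hT : T ∈ tracts 𝒯) (R : ℝ) :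
    Bornology.IsBounded {z ∈ closure T | z.re ≤ R} := by
  refine (hF.isBounded_tract_re_le hT (R + 1)).closure.subset fun z hz => ?_
  have hU : {w : ℂ | w.re < R + 1} ∈ 𝓝 z :=
    (isOpen_lt Complex.continuous_re continuous_const).mem_nhds (by
      simp only [mem_ofPred_eq]; linarith [hz.2])
  rw [mem_closure_iff_nhds] at *
  intro V hV
  obtain ⟨w, ⟨hwV, hwU⟩, hwT⟩ := mem_closure_iff_nhds.1 hz.1 _ (inter_mem hV hU)
  exact ⟨w, hwV, hwT, le_of_lt hwU⟩

theorem closure_tract_subset {T : Set ℂ} (hT : T ∈ tracts 𝒯) : closure T ⊆ closure 𝒯 :=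
  closure_mono fun _ hz => (connectedComponentIn_eq_of_mem hT hz).1

theorem invFunOn_mem (hF : IsBLog 𝒯 H F) {T : Set ℂ} (hT : T ∈ tracts 𝒯) {w : ℂ} (hw : w ∈ H) :
    Function.invFunOn F T w ∈ T :=
  Function.invFunOn_mem ((hF.bijective T hT).surjOn hw)

theorem apply_invFunOn (hF : IsBLog 𝒯 H F) {T : Set ℂ} (hT : T ∈ tracts 𝒯) {w : ℂ} (hw : w ∈ H) :
    F (Function.invFunOn F T w) = w :=
  Function.invFunOn_eq ((hF.bijective T hT).surjOn hw)

theorem differentiableOn_invFunOn (hF : IsBLog 𝒯 H F) {T : Set ℂ} (hT : T ∈ tracts 𝒯) :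
    DifferentiableOn ℂ (Function.invFunOn F T) H :=
  differentiableOn_of_injOn_of_rightInverse (hF.tract_jordan T hT).isOpen (hF.holomorphic T hT)
    (hF.bijective T hT).injOn (fun _ => hF.invFunOn_mem hT) (fun _ => hF.apply_invFunOn hT)
    (hF.bijective T hT).mapsTo

/-- Boundary points of a tract are not mapped into `H`. -/
theorem invFunOn_apply (hF : IsBLog 𝒯 H F) {T : Set ℂ} (hT : T ∈ tracts 𝒯) {z : ℂ}
    (hz : z ∈ closure T) (hFz : F z ∈ H) : Function.invFunOn F T (F z) = z := by
  have : (𝓝[T] z).NeBot := mem_closure_iff_nhdsWithin_neBot.1 hz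
  have h1 : Tendsto F (𝓝[T] z) (𝓝 (F z)) :=
    (hF.continuousOn_closure z (closure_tract_subset hT hz)).mono
      (subset_closure.trans (closure_tract_subset hT))
  have h2 : ContinuousAt (Function.invFunOn F T) (F z) :=
    ((hF.differentiableOn_invFunOn hT).differentiableAt
      (hF.H_jordan.isOpen.mem_nhds hFz)).continuousAt
  refine tendsto_nhds_unique (h2.tendsto.comp h1) ?_
  refine (tendsto_nhdsWithin_of_tendsto_nhds tendsto_id).congr' ?_
  filter_upwards [self_mem_nhdsWithin] with y hy
  have hyH := (hF.bijective T hT).mapsTo hy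
  exact (hF.bijective T hT).injOn hy (hF.invFunOn_mem hT hyH) (hF.apply_invFunOn hT hyH).symm

/-! ### Points with a given bounded address -/

variable {s : ℕ → Set ℂ}

theorem isContractingSystem (hF : IsBLog 𝒯 H F) (hdisj : IsDisjointType 𝒯 H)
    (hs : IsBoundedExternalAddress 𝒯 s) :
    IsContractingSystem H (⋃ T ∈ range s, closure T) (fun n => Function.invFunOn F (s n)) where
  isOpen := hF.H_jordan.isOpen
  isPreconnected := hF.H_jordan.isConnected.isPreconnected
  rightHalfPlane := hF.H_rightHalfPlane
  holomorphic n := hF.differentiableOn_invFunOn (hs.1 n)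
  mapsTo n w hw := mem_biUnion (mem_range_self n) (subset_closure (hF.invFunOn_mem (hs.1 n) hw))
  isClosed := hs.2.isClosed_biUnion fun _ _ => isClosed_closure
  subset := by
    refine iUnion₂_subset ?_
    rintro _ ⟨n, rfl⟩
    exact (closure_tract_subset (hs.1 n)).trans hdisj
  isBounded R := by
    refine Bornology.IsBounded.subset ((Bornology.isBounded_biUnion
      (f := fun T => {z ∈ closure T | z.re ≤ R}) hs.2).2 ?_) ?_
    · rintro _ ⟨n, rfl⟩
      exact hF.isBounded_closure_tract_re_le (hs.1 n) R
    · rintro z ⟨hz, hzR⟩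
      obtain ⟨T, hT, hzT⟩ := mem_iUnion₂.1 hz
      exact mem_biUnion hT ⟨hzT, hzR⟩
  ne_add n z hz w hw heq := by
    refine Set.disjoint_left.1 (hF.tract_disjoint _ (hs.1 n) 1 one_ne_zero)
      (hF.invFunOn_mem (hs.1 n) hz) ⟨_, hF.invFunOn_mem (hs.1 n) hw, ?_⟩
    rw [heq]; simp
  finite := by
    refine (hs.2.image (Function.invFunOn F)).subset ?_
    rintro _ ⟨n, rfl⟩
    exact mem_image_of_mem _ (mem_range_self n)

theorem iterate_mem (hdisj : IsDisjointType 𝒯 H) {z : ℂ} (hz : z ∈ juliaAddress 𝒯 F s) (n : ℕ) :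
    F^[n] z ∈ H :=
  hdisj (hz.1 n)

theorem invFunOn_iterate (hF : IsBLog 𝒯 H F) (hdisj : IsDisjointType 𝒯 H)
    (hs : IsBoundedExternalAddress 𝒯 s) {z : ℂ} (hz : z ∈ juliaAddress 𝒯 F s) (n : ℕ) :
    Function.invFunOn F (s n) (F^[n + 1] z) = F^[n] z := by
  have h := iterate_mem hdisj hz (n + 1)
  rw [Function.iterate_succ_apply'] at h ⊢
  exact hF.invFunOn_apply (hs.1 n) (hz.2 n) h

theorem backward_iterate (hF : IsBLog 𝒯 H F) (hdisj : IsDisjointType 𝒯 H)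
    (hs : IsBoundedExternalAddress 𝒯 s) {z : ℂ} (hz : z ∈ juliaAddress 𝒯 F s) (n : ℕ) :
    backward (fun n => Function.invFunOn F (s n)) 0 n (F^[n] z) = z := by
  induction n with
  | zero => rfl
  | succ n ih =>
    rw [backward_succ', zero_add, hF.invFunOn_iterate hdisj hs hz, ih]

/-- Points with the same bounded address whose orbits stay in a compact subset of `H` coincide. -/
theorem eq_of_forall_iterate_mem (hF : IsBLog 𝒯 H F) (hdisj : IsDisjointType 𝒯 H)
    (hs : IsBoundedExternalAddress 𝒯 s) {K : Set ℂ} (hK : IsCompact K) (hKH : K ⊆ H) {z w : ℂ}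
    (hz : z ∈ juliaAddress 𝒯 F s) (hw : w ∈ juliaAddress 𝒯 F s) (hzK : ∀ n, F^[n] z ∈ K)
    (hwK : ∀ n, F^[n] w ∈ K) : z = w := by
  have hu := (hF.isContractingSystem hdisj hs).tendstoUniformlyOn_backward_sub hK hKH
    (hKH (hzK 0))
  rw [Metric.tendstoUniformlyOn_iff] at hu
  refine eq_of_forall_dist_le fun ε hε => ?_
  obtain ⟨n, hn⟩ := (hu (ε / 2) (half_pos hε)).exists
  have h1 := hn _ (hzK n)
  have h2 := hn _ (hwK n)
  simp only [hF.backward_iterate hdisj hs hz, hF.backward_iterate hdisj hs hw, Pi.zero_apply,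
    dist_zero_left, Real.norm_of_nonneg dist_nonneg] at h1 h2
  exact (dist_triangle_right _ _ _).trans (by linarith)

/-- The orbit of a nonescaping point with bounded address stays in a compact subset of `H`. -/
theorem exists_compact_of_notMem_escaping (hF : IsBLog 𝒯 H F) (hdisj : IsDisjointType 𝒯 H)
    (hs : IsBoundedExternalAddress 𝒯 s) {z : ℂ} (hz : z ∈ juliaAddress 𝒯 F s)
    (hesc : z ∉ escaping 𝒯 F) : ∃ K, IsCompact K ∧ K ⊆ H ∧ ∀ n, F^[n] z ∈ K := by
  have hsys := hF.isContractingSystem hdisj hs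
  have hnot : ¬ Tendsto (fun n : ℕ => (F^[n] z).re) atTop atTop := fun h => hesc ⟨hz.1, h⟩
  rw [Filter.tendsto_atTop] at hnot
  push Not at hnot
  obtain ⟨R, hR⟩ := hnot
  obtain ⟨Q, hQc, hKQ, hQH, hQ⟩ := hsys.exists_invariant_compact (hsys.isCompact_re_le R)
    fun z hz => hsys.subset hz.1
  refine ⟨Q, hQc, hQH, fun n => ?_⟩
  obtain ⟨N, hnN, hN⟩ := (frequently_atTop.1 hR) n
  have hNQ : F^[N] z ∈ Q := hKQ ⟨mem_biUnion (mem_range_self N) (hz.2 N), hN.le⟩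
  clear hN
  -- Pull back from the return time `N` to `n` along the branches, which preserve `Q`.
  induction N, hnN using Nat.le_induction with
  | base => exact hNQ
  | succ N _ ih =>
    exact ih (hF.invFunOn_iterate hdisj hs hz N ▸ hQ N hNQ)

theorem exists_mem_juliaAddress_compact (hF : IsBLog 𝒯 H F) (hdisj : IsDisjointType 𝒯 H)
    (hs : IsBoundedExternalAddress 𝒯 s) :
    ∃ z ∈ juliaAddress 𝒯 F s, ∃ K, IsCompact K ∧ K ⊆ H ∧ ∀ n, F^[n] z ∈ K := by
  have hsys := hF.isContractingSystem hdisj hs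
  obtain ⟨p, hp⟩ := hF.H_jordan.isConnected.nonempty
  obtain ⟨Q, hQc, hpQ, hQH, hQ⟩ := hsys.exists_invariant_compact
    (isCompact_singleton (x := p)) (singleton_subset_iff.2 hp)
  obtain ⟨g, hg⟩ : ∃ g, g = fun n => Function.invFunOn F (s n) := ⟨_, rfl⟩
  rw [← hg] at hsys
  replace hQ : ∀ n, MapsTo (g n) Q Q := by rw [hg]; exact hQ
  have hcomp : ∀ n, IsCompact (backward g 0 n '' Q) := fun n =>
    hQc.image_of_continuousOn ((hsys.differentiableOn_backward 0 n).continuousOn.mono hQH)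
  obtain ⟨z, hz⟩ := IsCompact.nonempty_iInter_of_sequence_nonempty_isCompact_isClosed
    (fun n => backward g 0 n '' Q)
    (fun n => by
      rintro _ ⟨q, hq, rfl⟩
      exact ⟨g (0 + n) q, hQ _ hq, (backward_succ' g 0 n q).symm⟩)
    (fun n => ⟨_, mem_image_of_mem _ (singleton_subset_iff.1 hpQ)⟩) (hcomp 0)
    (fun n => (hcomp n).isClosed)
  rw [mem_iInter] at hz
  have hit : ∀ a n, ∀ q ∈ H, F^[n] (backward g a n q) = q := by
    intro a n q hq
    induction n generalizing a with
    | zero => rfl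
    | succ n ih =>
      have hFg : ∀ y ∈ H, F (g a y) = y := fun y hy => by
        rw [hg]; exact hF.apply_invFunOn (hs.1 a) hy
      rw [Function.iterate_succ_apply, backward, Function.comp_apply,
        hFg _ (mapsTo_backward hsys.mapsTo_self (a + 1) n hq), ih]
  have hzQ : ∀ n, F^[n] z ∈ Q := fun n => by
    obtain ⟨q, hq, rfl⟩ := hz n
    rwa [hit 0 n q (hQH hq)]
  -- Level `n + 1` is needed: the extra branch places `F^[n] z` inside `s n`.
  have hzs : ∀ n, F^[n] z ∈ s n := fun n => by
    obtain ⟨q, hq, rfl⟩ := hz (n + 1)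
    rw [backward_succ', zero_add, hit 0 n _ (hQH (hQ n hq)), hg]
    exact hF.invFunOn_mem (hs.1 n) (hQH hq)
  exact ⟨z, ⟨fun n => closure_tract_subset (hs.1 n) (subset_closure (hzs n)),
    fun n => subset_closure (hzs n)⟩, Q, hQc, hQH, hzQ⟩

end IsBLog

theorem notMem_escaping_of_isBounded {𝒯 : Set ℂ} {F : ℂ → ℂ} {z : ℂ}
    (h : Bornology.IsBounded (range fun n : ℕ => F^[n] z)) : z ∉ escaping 𝒯 F := by
  rintro ⟨-, hlim⟩
  obtain ⟨C, -, hC⟩ := h.exists_pos_norm_le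
  obtain ⟨n, hn⟩ := (hlim.eventually_gt_atTop C).exists
  exact absurd ((Complex.re_le_norm _).trans (hC _ (mem_range_self n))) (not_le.2 hn)

end BLog

theorem lemma6p5 (𝒯 H : Set ℂ) (F : ℂ → ℂ) (hF : BLog.IsBLog 𝒯 H F)
    (hdisj : BLog.IsDisjointType 𝒯 H) (s : ℕ → Set ℂ)
    (hs : BLog.IsBoundedExternalAddress 𝒯 s) :
    ∃ z₀ : ℂ, BLog.juliaAddress 𝒯 F s \ BLog.escaping 𝒯 F = {z₀} ∧
      Bornology.IsBounded (Set.range fun n : ℕ => F^[n] z₀) := by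
  obtain ⟨z₀, hz₀, K, hK, hKH, hz₀K⟩ := hF.exists_mem_juliaAddress_compact hdisj hs
  have hbdd : Bornology.IsBounded (Set.range fun n : ℕ => F^[n] z₀) :=
    hK.isBounded.subset (Set.range_subset_iff.2 hz₀K)
  refine ⟨z₀, Set.eq_singleton_iff_unique_mem.2
    ⟨⟨hz₀, BLog.notMem_escaping_of_isBounded hbdd⟩, ?_⟩, hbdd⟩
  rintro z ⟨hz, hesc⟩
  obtain ⟨K', hK', hKH', hzK'⟩ := hF.exists_compact_of_notMem_escaping hdisj hs hz hesc
  exact hF.eq_of_forall_iterate_mem hdisj hs (hK.union hK') (Set.union_subset hKH hKH') hz hz₀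
    (fun n => Or.inr (hzK' n)) (fun n => Or.inl (hz₀K n))
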